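/- Let $G$ be a finite multigraph, possibly with loops and parallel edges, and let $0 \le \ell \le k$ be integers. Call $G$ *$(k,\ell)$-sparse* if every subgraph of $G$ with $n'$ vertices and $m' \ge 1$ edges satisfies $m' \le kn' - \ell$, and *$(k,\ell)$-tight* if it is $(k,\ell)$-sparse and has exactly $kn-\ell$ edges, where $n$ is its number of vertices. A *map-graph* is a graph that admits an orientation in which every vertex has out-degree exactly one. A *$(k,\ell)$-maps-and-trees decomposition* of $G$ is a partition of the edge set of $G$ into the edge sets of $k-\ell$ spanning subgraphs that are map-graphs and $\ell$ spanning trees. Then $G$ is $(k,\ell)$-tight if and only if $G$ has a $(k,\ell)$-maps-and-trees decomposition. In particular (the case $\ell = k$), $G$ is $(k,k)$-tight if and only if its edge set can be partitioned into the edge sets of $k$ spanning trees of $G$. -/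

import Mathlib

/-!
Sparse multigraphs and maps-and-trees decompositions. A graph is Mathlib's multigraph
`Graph α β` (loops and parallel edges allowed), with vertex set `V(G)` and edge set `E(G)`;
`H ≤ G` says that `H` is a subgraph of `G`, and `H ≤s G` that it is a spanning subgraph.
-/

namespace Graph

section MapsAndTrees

variable {α β : Type*}

/-- `G` is `(k, ℓ)`-sparse: every non-empty subgraph, with `n'` vertices and `m'` edges, satisfies
`m' ≤ k n' - ℓ` (an inequality of integers). As usual for sparsity counts, non-empty means having
at least one edge; for `ℓ ≤ k` the inequality is automatic for a subgraph with at least one vertex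
and no edges. -/
def IsSparse (G : Graph α β) (k ℓ : ℕ) : Prop :=
  ∀ H : Graph α β, H ≤ G → E(H).Nonempty →
    (E(H).ncard : ℤ) ≤ (k : ℤ) * (V(H).ncard : ℤ) - (ℓ : ℤ)

/-- `G` is `(k, ℓ)`-tight: it is `(k, ℓ)`-sparse and has exactly `k n - ℓ` edges, where `n` is its
number of vertices. -/
def IsTight (G : Graph α β) (k ℓ : ℕ) : Prop :=
  G.IsSparse k ℓ ∧ (E(G).ncard : ℤ) = (k : ℤ) * (V(G).ncard : ℤ) - (ℓ : ℤ)

/-- An orientation of `G`: every edge gets a tail and a head, which are its two ends (both are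
the same vertex if the edge is a loop). -/
structure EdgeOrientation (G : Graph α β) where
  tail : E(G) → α
  head : E(G) → α
  isLink : ∀ e : E(G), G.IsLink (e : β) (tail e) (head e)

/-- The out-degree of a vertex: the number of edges whose tail it is. -/
noncomputable def EdgeOrientation.outDegree {G : Graph α β} (O : G.EdgeOrientation) (v : α) : ℕ∞ :=
  {e : E(G) | O.tail e = v}.encard

/-- A map-graph: some orientation gives every vertex out-degree exactly one. -/
def IsMapGraph (G : Graph α β) : Prop :=
  ∃ O : G.EdgeOrientation, ∀ v ∈ V(G), O.outDegree v = 1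

/-- `G` has a cycle: for some `n`, there are `n + 1` distinct vertices and `n + 1` distinct edges
such that edge `i` joins vertex `i` to vertex `i + 1`, with indices modulo `n + 1`. A loop is a
cycle with one edge, and two parallel edges form a cycle with two edges. -/
def HasCycle (G : Graph α β) : Prop :=
  ∃ (n : ℕ) (v : Fin (n + 1) → α) (e : Fin (n + 1) → β),
    Function.Injective v ∧ Function.Injective e ∧ ∀ i, G.IsLink (e i) (v i) (v (i + 1))

/-- `G` is connected: it has a vertex and any two of its vertices are joined by a walk. -/
def IsConnected (G : Graph α β) : Prop :=
  V(G).Nonempty ∧ ∀ x ∈ V(G), ∀ y ∈ V(G), Relation.ReflTransGen G.Adj x y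

/-- A tree: a connected graph without cycles. -/
def IsTree (G : Graph α β) : Prop :=
  G.IsConnected ∧ ¬ G.HasCycle

/-- The subgraphs `H i` decompose `G`: they are pairwise edge-disjoint and every edge of `G`
belongs to one of them. -/
def IsDecomposition {ι : Type*} (G : Graph α β) (H : ι → Graph α β) : Prop :=
  (∀ i, H i ≤ G) ∧ (∀ i j, i ≠ j → Disjoint E(H i) E(H j)) ∧ (⋃ i, E(H i)) = E(G)

/-- `G` is a `(k, ℓ)`-maps-and-trees (meant for `ℓ ≤ k`): it decomposes into `k - ℓ` spanning
map-graphs and `ℓ` spanning trees, all edge-disjoint. -/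
def IsMapsAndTrees (G : Graph α β) (k ℓ : ℕ) : Prop :=
  ∃ (M : Fin (k - ℓ) → Graph α β) (T : Fin ℓ → Graph α β),
    G.IsDecomposition (Sum.elim M T) ∧
    (∀ i, M i ≤s G ∧ (M i).IsMapGraph) ∧
    (∀ j, T j ≤s G ∧ (T j).IsTree)

/-- `G` is a `k`-arborescence: it decomposes into `k` edge-disjoint spanning trees. -/
def IsArborescence (G : Graph α β) (k : ℕ) : Prop :=
  ∃ T : Fin k → Graph α β, G.IsDecomposition T ∧ ∀ j, T j ≤s G ∧ (T j).IsTree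

end MapsAndTrees

end Graph

/-! Map-graphs and trees are extremal for one kind of bound, `EdgeBounded d`: a map-graph has at
most `|W|` edges inside any nonempty finite vertex set `W`, a tree at most `|W| - 1`, and over all
vertices equality holds. Conversely, bound plus equality characterise them
(`isMapGraph_iff_edgeBounded`, via Hall's theorem, and `isTree_iff_edgeBounded`, via linear algebra
over `ZMod 2`). Adding the bounds over a decomposition gives tightness.

For the other direction, take `k - ℓ` copies of the function counting the ends of an edge set and
`ℓ` copies of the graphic rank. All are monotone and submodular. Sparsity, applied to each connected
component, shows that their sum dominates cardinality (`card_le_of_sparse`), so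
`exists_coloring_of_card_le_sum` splits the edges into `k` classes, each obeying its own bound.
Tightness makes the total edge count the largest these bounds allow, hence every bound is an
equality and the classes are map-graphs and trees. -/

namespace Graph

/-! ### Splitting a set along submodular functions. -/

section Coloring

open scoped Classical

variable {ι κ : Type*} [Fintype ι] [Fintype κ]

/-- Rado's theorem for finitely many monotone submodular functions: if their sum dominates
cardinality, then the ground set can be coloured so that the `i`-th function dominates cardinality
on the `i`-th colour class. -/
theorem exists_coloring_of_card_le_sum (r : κ → Finset ι → ℕ) (h0 : ∀ i, r i ∅ = 0)
    (hmono : ∀ i, Monotone (r i))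
    (hsub : ∀ i A B, r i (A ∪ B) + r i (A ∩ B) ≤ r i A + r i B)
    (h : ∀ A : Finset ι, A.card ≤ ∑ i, r i A) :
    ∃ c : ι → κ, ∀ i (A : Finset ι), (∀ e ∈ A, c e = i) → A.card ≤ r i A := by
  -- `S e` lists the colours still allowed at `e`; a minimal good `S` turns out to allow exactly one
  -- colour everywhere.
  let good : Set (ι → Finset κ) :=
    {S | ∀ A : Finset ι, A.card ≤ ∑ i, r i (A.filter (fun e => i ∈ S e))}
  have hne : good.Nonempty := ⟨fun _ => Finset.univ, fun A => by simpa using h A⟩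
  obtain ⟨S, hS, hmin⟩ := good.toFinite.exists_minimal hne
  have hS1 : ∀ e, (S e).Nonempty := by
    intro e
    by_contra hcon
    rw [Finset.not_nonempty_iff_eq_empty] at hcon
    have := hS {e}
    simp [Finset.filter_singleton, hcon, h0] at this
  have hdel : ∀ e, ∀ i ∈ S e, ∃ A : Finset ι,
      ∑ j, r j (A.filter (fun f => j ∈ Function.update S e ((S e).erase i) f)) < A.card := by
    intro e i hi
    by_contra! hcon
    have hle : Function.update S e ((S e).erase i) ≤ S := by
      intro f
      by_cases hf : f = e
      · subst hf; simpa using Finset.erase_subset i (S f)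
      · simp [hf]
    have := hmin hcon hle e
    simp only [Function.update_self] at this
    exact Finset.notMem_erase i (S e) (this hi)
  have huniq : ∀ e, ∀ i ∈ S e, ∀ j ∈ S e, i = j := by
    intro e i hi j hj
    by_contra hij
    obtain ⟨A, hA⟩ := hdel e i hi
    obtain ⟨B, hB⟩ := hdel e j hj
    -- Deleting a colour at `e` changes nothing on sets that avoid `e`, so a violated set contains
    -- `e`.
    have hmem : ∀ (C : Finset ι) (i : κ), i ∈ S e →
        ∑ j, r j (C.filter (fun f => j ∈ Function.update S e ((S e).erase i) f)) < C.card →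
        e ∈ C := by
      intro C i _ hC
      by_contra heC
      refine absurd (hS C) (not_le.2 (lt_of_eq_of_lt ?_ hC))
      refine Finset.sum_congr rfl fun j _ => ?_
      congr 1
      refine Finset.filter_congr fun f hf => ?_
      have : f ≠ e := fun h => heC (h ▸ hf)
      simp [this]
    have heA := hmem A i hi hA
    have heB := hmem B j hj hB
    have h1 := hS (A ∪ B)
    have h2 := hS ((A ∩ B).erase e)
    -- As `i ≠ j`, each colour of `e` survives in at least one of the two updates, so the filtered
    -- unions lose nothing. The element `e` is dropped from the intersection only, which costs 1,
    -- whereas the two violations gain 2: a contradiction.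
    have h3 : ∑ l, r l ((A ∪ B).filter (fun f => l ∈ S f))
          + ∑ l, r l (((A ∩ B).erase e).filter (fun f => l ∈ S f)) ≤
        ∑ l, r l (A.filter (fun f => l ∈ Function.update S e ((S e).erase i) f))
          + ∑ l, r l (B.filter (fun f => l ∈ Function.update S e ((S e).erase j) f)) := by
      rw [← Finset.sum_add_distrib, ← Finset.sum_add_distrib]
      refine Finset.sum_le_sum fun l _ => le_trans (add_le_add ?_ ?_) (hsub l _ _)
      · refine hmono l fun f hf => ?_
        simp only [Finset.mem_filter, Finset.mem_union] at hf ⊢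
        by_cases hfe : f = e
        · subst hfe
          by_cases hl : l = i
          · right; subst hl; simp [heB, hij, hf.2]
          · left; simp [heA, hl, hf.2]
        · simpa [hfe, ← or_and_right] using hf
      · refine hmono l fun f hf => ?_
        simp only [Finset.mem_filter, Finset.mem_inter, Finset.mem_erase] at hf ⊢
        simp [hf.1.1, hf.1.2.1, hf.1.2.2, hf.2]
    have h4 := Finset.card_union_add_card_inter A B
    have h5 := Finset.card_erase_add_one (Finset.mem_inter.2 ⟨heA, heB⟩)
    omega
  choose c hc using hS1
  refine ⟨c, fun i A hA => (hS A).trans ?_⟩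
  rw [Finset.sum_eq_single i]
  · exact hmono i (Finset.filter_subset _ _)
  · intro j _ hj
    rw [Finset.filter_false_of_mem, h0]
    intro e he hje
    exact hj ((huniq e j hje _ (hc e)).trans (hA e he))
  · simp

end Coloring

end Graph
-- Vertex counts and graphic rank of edge sets.
namespace Graph

section EndpointRank

open Submodule

open scoped Classical

variable {ι α : Type*} (a b : ι → α)

/-- The set of end vertices of a set of edges. -/
noncomputable def endpoints (A : Finset ι) : Finset α := A.image a ∪ A.image b

/-- The incidence vector over `ZMod 2` of an edge with ends `x` and `y`. -/
noncomputable def edgeVector (x y : α) : α →₀ ZMod 2 := Finsupp.single x 1 + Finsupp.single y 1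

/-- The span of the incidence vectors of a set of edges. -/
noncomputable def edgeSpan (A : Finset ι) : Submodule (ZMod 2) (α →₀ ZMod 2) :=
  span (ZMod 2) ((fun e => edgeVector (a e) (b e)) '' A)

/-- The graphic rank of a set of edges. -/
noncomputable def edgeRank (A : Finset ι) : ℕ := Module.finrank (ZMod 2) (edgeSpan a b A)

lemma edgeVector_comm (x y : α) : edgeVector x y = edgeVector y x := add_comm _ _

lemma edgeVector_self (x : α) : edgeVector x x = 0 := by
  rw [edgeVector, ← Finsupp.single_add, CharTwo.add_self_eq_zero, Finsupp.single_zero]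

lemma edgeVector_add (x y z : α) : edgeVector x y + edgeVector y z = edgeVector x z := by
  have h : (Finsupp.single y 1 + Finsupp.single y 1 : α →₀ ZMod 2) = 0 := edgeVector_self y
  calc edgeVector x y + edgeVector y z
      = Finsupp.single x 1 + Finsupp.single z 1
        + (Finsupp.single y 1 + Finsupp.single y 1) := by unfold edgeVector; abel
    _ = _ := by rw [h, add_zero, edgeVector]

variable {a b}

lemma mem_endpoints {A : Finset ι} {v : α} :
    v ∈ endpoints a b A ↔ ∃ e ∈ A, a e = v ∨ b e = v := by
  simp only [endpoints, Finset.mem_union, Finset.mem_image]; grind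

lemma endpoints_subset_iff {A : Finset ι} {W : Finset α} :
    endpoints a b A ⊆ W ↔ ∀ e ∈ A, a e ∈ W ∧ b e ∈ W := by
  simp only [Finset.subset_iff, mem_endpoints]; grind

lemma endpoints_mono : Monotone (endpoints a b) := fun A B h => by
  intro v; simp only [mem_endpoints]; grind

lemma endpoints_union (A B : Finset ι) :
    endpoints a b (A ∪ B) = endpoints a b A ∪ endpoints a b B := by
  ext v; simp only [mem_endpoints, Finset.mem_union]; grind

lemma endpoints_insert (e : ι) (B : Finset ι) :
    endpoints a b (insert e B) = insert (a e) (insert (b e) (endpoints a b B)) := by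
  ext v; simp only [mem_endpoints, Finset.mem_insert]; grind

lemma card_endpoints_submodular (A B : Finset ι) :
    (endpoints a b (A ∪ B)).card + (endpoints a b (A ∩ B)).card ≤
      (endpoints a b A).card + (endpoints a b B).card := by
  rw [endpoints_union, ← Finset.card_union_add_card_inter (endpoints a b A)]
  refine Nat.add_le_add_left (Finset.card_le_card ?_) _
  exact Finset.subset_inter (endpoints_mono (Finset.inter_subset_left : A ∩ B ⊆ A))
    (endpoints_mono (Finset.inter_subset_right : A ∩ B ⊆ B))

instance (A : Finset ι) : FiniteDimensional (ZMod 2) (edgeSpan a b A) :=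
  FiniteDimensional.span_of_finite _ (A.finite_toSet.image _)

lemma edgeSpan_mono : Monotone (edgeSpan a b) := fun _ _ h =>
  span_mono (Set.image_mono (Finset.coe_subset.2 h))

lemma edgeSpan_union (A B : Finset ι) :
    edgeSpan a b (A ∪ B) = edgeSpan a b A ⊔ edgeSpan a b B := by
  simp [edgeSpan, Set.image_union, span_union]

lemma edgeVector_mem_edgeSpan {A : Finset ι} {e : ι} (he : e ∈ A) :
    edgeVector (a e) (b e) ∈ edgeSpan a b A :=
  subset_span ⟨e, he, rfl⟩

lemma edgeRank_mono : Monotone (edgeRank a b) := fun _ _ h =>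
  finrank_mono (edgeSpan_mono h)

lemma edgeRank_empty : edgeRank a b ∅ = 0 := by
  rw [edgeRank, edgeSpan, Finset.coe_empty, Set.image_empty, span_empty, finrank_bot]

lemma edgeRank_submodular (A B : Finset ι) :
    edgeRank a b (A ∪ B) + edgeRank a b (A ∩ B) ≤ edgeRank a b A + edgeRank a b B := by
  have h : edgeSpan a b (A ∩ B) ≤ edgeSpan a b A ⊓ edgeSpan a b B :=
    le_inf (edgeSpan_mono Finset.inter_subset_left) (edgeSpan_mono Finset.inter_subset_right)
  unfold edgeRank
  rw [edgeSpan_union, ← finrank_sup_add_finrank_inf_eq (edgeSpan a b A)]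
  exact Nat.add_le_add_left (finrank_mono h) _

lemma edgeSpan_le_supported (A : Finset ι) :
    edgeSpan a b A ≤ Finsupp.supported (ZMod 2) (ZMod 2) (endpoints a b A : Set α) := by
  refine span_le.2 ?_
  rintro _ ⟨e, he, rfl⟩
  have ha : a e ∈ (endpoints a b A : Set α) := mem_endpoints.2 ⟨e, he, .inl rfl⟩
  have hb : b e ∈ (endpoints a b A : Set α) := mem_endpoints.2 ⟨e, he, .inr rfl⟩
  exact Submodule.add_mem _ (Finsupp.single_mem_supported (ZMod 2) (1 : ZMod 2) ha)
    (Finsupp.single_mem_supported (ZMod 2) (1 : ZMod 2) hb)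

/-- The two spans are supported on disjoint sets of coordinates. -/
lemma edgeRank_union_of_disjoint {A B : Finset ι}
    (h : Disjoint (endpoints a b A) (endpoints a b B)) :
    edgeRank a b (A ∪ B) = edgeRank a b A + edgeRank a b B := by
  unfold edgeRank
  have hd : Disjoint (edgeSpan a b A) (edgeSpan a b B) :=
    (Finsupp.disjoint_supported_supported (Finset.disjoint_coe.2 h)).mono (edgeSpan_le_supported A)
      (edgeSpan_le_supported B)
  rw [edgeSpan_union, ← finrank_sup_add_finrank_inf_eq, hd.eq_bot, finrank_bot, add_zero]

/-- The star at a vertex `w` of `W` generates every incidence vector inside `W` and has `|W| - 1`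
members. -/
lemma edgeRank_add_one_le {A : Finset ι} {W : Finset α} (hW : W.Nonempty)
    (h : ∀ e ∈ A, a e ∈ W ∧ b e ∈ W) : edgeRank a b A + 1 ≤ W.card := by
  obtain ⟨w, hw⟩ := hW
  have hle : edgeSpan a b A ≤ span (ZMod 2) ((W.erase w).image (edgeVector · w) : Finset _) := by
    have key : ∀ v ∈ W, edgeVector v w ∈
        span (ZMod 2) (((W.erase w).image (edgeVector · w) : Finset _) : Set (α →₀ ZMod 2)) := by
      intro v hv
      by_cases hvw : v = w
      · rw [hvw, edgeVector_self]; exact zero_mem _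
      · exact subset_span (Finset.mem_coe.2 (Finset.mem_image_of_mem _ (by simp [hv, hvw])))
    refine span_le.2 ?_
    rintro _ ⟨e, he, rfl⟩
    have := add_mem (key _ (h e he).1) (key _ (h e he).2)
    rwa [edgeVector_comm (b e) w, edgeVector_add] at this
  have h1 : edgeRank a b A ≤ (W.erase w).card :=
    (finrank_mono hle).trans ((finrank_span_finset_le_card _).trans Finset.card_image_le)
  have := Finset.card_erase_add_one hw
  omega

/-- The vector of `e` is nonzero at `v`, where all of `edgeSpan a b B` vanishes. -/
lemma edgeRank_insert_of_notMem_endpoints {B : Finset ι} {e : ι} {v : α}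
    (hv : v ∉ endpoints a b B) (hab : a e ≠ b e) (hve : a e = v ∨ b e = v) :
    edgeRank a b B + 1 ≤ edgeRank a b (insert e B) := by
  refine finrank_lt_finrank_of_lt (lt_of_le_of_ne (edgeSpan_mono (Finset.subset_insert _ _)) ?_)
  intro heq
  have h1 : edgeVector (a e) (b e) ∈ edgeSpan a b B :=
    heq ▸ edgeVector_mem_edgeSpan (Finset.mem_insert_self e B)
  have h2 : (edgeVector (a e) (b e)) v = 0 :=
    (Finsupp.mem_supported' _ _).1 (edgeSpan_le_supported B h1) v (by simpa using hv)
  rcases hve with rfl | rfl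
  · simp [edgeVector, hab] at h2
  · simp [edgeVector, hab] at h2

/-- Every nonempty edge set splits into a connected part and a part that does not touch it. -/
lemma exists_connected_part {A : Finset ι} (hA : A.Nonempty) :
    ∃ B ⊆ A, B.Nonempty ∧ (endpoints a b B).card ≤ edgeRank a b B + 1 ∧
      Disjoint (endpoints a b B) (endpoints a b (A \ B)) := by
  let s : Set (Finset ι) :=
    {B | B ⊆ A ∧ B.Nonempty ∧ (endpoints a b B).card ≤ edgeRank a b B + 1}
  have hfin : s.Finite := A.powerset.finite_toSet.subset fun B hB => by simpa using hB.1
  have hne : s.Nonempty := by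
    obtain ⟨e, he⟩ := hA
    refine ⟨{e}, by simpa using he, by simp, ?_⟩
    by_cases hab : a e = b e
    · simp [endpoints, hab]
    · have h1 := edgeRank_insert_of_notMem_endpoints (a := a) (b := b) (B := ∅) (e := e)
        (by simp [mem_endpoints]) hab (.inl rfl)
      simp only [endpoints, Finset.image_singleton, insert_empty_eq] at h1 ⊢
      have := Finset.card_union_le {a e} {b e}
      simp only [Finset.card_singleton] at this
      omega
  -- An edge outside a maximal `B` that touches it could be added: either it brings no new vertex,
  -- or it brings exactly one and raises the rank.
  obtain ⟨B, ⟨hBA, hB, hcard⟩, hmax⟩ := hfin.exists_maximal hne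
  refine ⟨B, hBA, hB, hcard, ?_⟩
  rw [Finset.disjoint_left]
  intro v hvB hvD
  obtain ⟨e, he, hev⟩ := mem_endpoints.1 hvD
  obtain ⟨heA, heB⟩ := Finset.mem_sdiff.1 he
  refine heB (hmax (y := insert e B) ⟨Finset.insert_subset heA hBA, by simp, ?_⟩
    (Finset.subset_insert e B) (Finset.mem_insert_self e B))
  by_cases hin : a e ∈ endpoints a b B ∧ b e ∈ endpoints a b B
  · rw [endpoints_insert, Finset.insert_eq_of_mem hin.2, Finset.insert_eq_of_mem hin.1]
    exact hcard.trans (Nat.add_le_add_right (edgeRank_mono (Finset.subset_insert e B)) 1)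
  · obtain ⟨w, hw, hab, hew, hends⟩ : ∃ w, w ∉ endpoints a b B ∧ a e ≠ b e ∧
        (a e = w ∨ b e = w) ∧
        endpoints a b (insert e B) = insert w (endpoints a b B) := by
      rw [endpoints_insert]
      rcases hev with rfl | rfl
      · have hb : b e ∉ endpoints a b B := fun hb => hin ⟨hvB, hb⟩
        refine ⟨b e, hb, fun h => hb (h ▸ hvB), .inr rfl, ?_⟩
        rw [Finset.insert_comm, Finset.insert_eq_of_mem hvB]
      · have ha : a e ∉ endpoints a b B := fun ha => hin ⟨ha, hvB⟩
        refine ⟨a e, ha, fun h => ha (h ▸ hvB), .inl rfl, ?_⟩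
        rw [Finset.insert_eq_of_mem hvB]
    have h1 := edgeRank_insert_of_notMem_endpoints hw hab hew
    rw [hends, Finset.card_insert_of_notMem hw]
    omega

/-- A sparse edge set has at most `m` times its vertex count plus `l` times its rank elements. -/
lemma card_le_of_sparse {m l : ℕ}
    (h : ∀ A : Finset ι, A.Nonempty → A.card + l ≤ (m + l) * (endpoints a b A).card)
    (A : Finset ι) : A.card ≤ m * (endpoints a b A).card + l * edgeRank a b A := by
  induction A using Finset.strongInduction with
  | H A ih =>
    rcases A.eq_empty_or_nonempty with rfl | hA
    · simp
    obtain ⟨B, hBA, hB, hcard, hdisj⟩ := exists_connected_part (a := a) (b := b) hA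
    have h1 := ih (A \ B) (Finset.sdiff_ssubset hBA hB)
    have h2 := h B hB
    have h3 : A = B ∪ (A \ B) := (Finset.union_sdiff_of_subset hBA).symm
    have h4 := edgeRank_union_of_disjoint hdisj
    have h5 := Finset.card_union_of_disjoint hdisj
    rw [← endpoints_union] at h5
    rw [← h3] at h4 h5
    have h6 := Finset.card_sdiff_add_card_eq_card hBA
    rw [h4, h5]
    -- On the connected part `B`, `|B| + l ≤ (m + l)|V(B)|` and `|V(B)| ≤ rank + 1` give the bound;
    -- the rest is induction and additivity.
    nlinarith [Nat.mul_le_mul_left l hcard]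

end EndpointRank

end Graph
-- Trees and map-graphs characterised by edge bounds.
namespace Graph

section EdgeBound

open scoped Classical

variable {α β : Type*} {G H T M : Graph α β}

/-- Any edges of `H` whose ends lie in a nonempty finite set of vertices are, in number, at most
the size of that set minus `d`. -/
def EdgeBounded (H : Graph α β) (d : ℕ) : Prop :=
  ∀ F ⊆ E(H), ∀ W : Set α, W.Finite → W.Nonempty →
    (∀ e ∈ F, ∀ x y, H.IsLink e x y → x ∈ W ∧ y ∈ W) → F.ncard + d ≤ W.ncard

lemma card_filter_val_mem {E F : Set β} [Fintype E] (h : F ⊆ E) :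
    (Finset.univ.filter fun e : E => e.1 ∈ F).card = F.ncard := by
  rw [← Set.ncard_coe_finset, ← Set.ncard_image_of_injective _ Subtype.val_injective]
  congr 1
  ext e
  simpa using @h e

lemma exists_ends (G : Graph α β) : ∃ a b : E(G) → α, ∀ e : E(G), G.IsLink e (a e) (b e) := by
  choose a b h using fun e : E(G) => G.exists_isLink_of_mem_edgeSet e.2
  exact ⟨a, b, h⟩

lemma edgeVector_eq_of_isLink {e : β} {x y x' y' : α} (h : G.IsLink e x y)
    (h' : G.IsLink e x' y') : edgeVector x y = edgeVector x' y' := by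
  rcases h.eq_and_eq_or_eq_and_eq h' with ⟨rfl, rfl⟩ | ⟨rfl, rfl⟩
  · rfl
  · exact edgeVector_comm _ _

/-- A cycle has as many edges as vertices. -/
lemma EdgeBounded.not_hasCycle (h : T.EdgeBounded 1) : ¬ T.HasCycle := by
  rintro ⟨n, v, e, hv, he, hl⟩
  have := h (Set.range e) (by rintro _ ⟨i, rfl⟩; exact (hl i).edge_mem) (Set.range v)
    (Set.finite_range v) (Set.range_nonempty v) (by
      rintro _ ⟨i, rfl⟩ x y hxy
      rcases hxy.eq_and_eq_or_eq_and_eq (hl i) with ⟨rfl, rfl⟩ | ⟨rfl, rfl⟩ <;> simp)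
  rw [Set.ncard_range_of_injective he, Set.ncard_range_of_injective hv] at this
  simp at this

lemma EdgeBounded.isConnected (h : T.EdgeBounded 1) (hV : V(T).Finite) (hE : E(T).Finite)
    (hcard : E(T).ncard + 1 = V(T).ncard) : T.IsConnected := by
  refine ⟨(Set.ncard_pos hV).1 (by omega), fun x hx y hy => ?_⟩
  by_contra hxy
  -- No edge leaves the component `C` of `x`. Bounding the edges inside `C` and outside it
  -- separately loses 1 each time, leaving at most `|V| - 2` edges.
  let C : Set α := {z | z ∈ V(T) ∧ Relation.ReflTransGen T.Adj x z}
  let F : Set β := {e | e ∈ E(T) ∧ ∀ u w, T.IsLink e u w → u ∈ C ∧ w ∈ C}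
  have hCV : C ⊆ V(T) := fun z hz => hz.1
  have hFE : F ⊆ E(T) := fun e he => he.1
  have h1 := h F hFE C (hV.subset hCV) ⟨x, hx, .refl⟩ fun e he => he.2
  have hadj : ∀ u w, T.Adj u w → u ∈ C → w ∈ C := fun u w huw hu =>
    ⟨huw.right_mem, hu.2.tail huw⟩
  have h2 := h (E(T) \ F) Set.sdiff_subset (V(T) \ C) (hV.subset Set.sdiff_subset)
    ⟨y, hy, fun hyC => hxy hyC.2⟩ (by
      intro e he u w huw
      have key : u ∉ C ∧ w ∉ C := by
        by_contra hcon
        have hu : u ∈ C ∧ w ∈ C := by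
          by_cases hu : u ∈ C
          · exact ⟨hu, hadj u w huw.adj hu⟩
          · have hw : w ∈ C := by_contra fun hw => hcon ⟨hu, hw⟩
            exact ⟨hadj w u huw.adj.symm hw, hw⟩
        refine he.2 ⟨he.1, fun u' w' huw' => ?_⟩
        rcases huw'.eq_and_eq_or_eq_and_eq huw with ⟨rfl, rfl⟩ | ⟨rfl, rfl⟩
        exacts [hu, hu.symm]
      exact ⟨⟨huw.left_mem, key.1⟩, huw.right_mem, key.2⟩)
  have h3 := Set.ncard_sdiff_add_ncard_of_subset hFE hE
  have h4 := Set.ncard_sdiff_add_ncard_of_subset hCV hV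
  omega

/-- One basis vector together with the incidence vectors spans every basis vector of `V(T)`; compare
dimensions. -/
lemma IsConnected.ncard_vertexSet_le (h : T.IsConnected) (hV : V(T).Finite) (hE : E(T).Finite) :
    V(T).ncard ≤ E(T).ncard + 1 := by
  have : Fintype E(T) := hE.fintype
  obtain ⟨w, hw⟩ := h.1
  obtain ⟨a, b, hab⟩ := T.exists_ends
  let S : Finset (α →₀ ZMod 2) :=
    insert (Finsupp.single w 1) (Finset.univ.image fun e => edgeVector (a e) (b e))
  have key : ∀ v, Relation.ReflTransGen T.Adj w v →
      Finsupp.single v 1 ∈ Submodule.span (ZMod 2) (S : Set (α →₀ ZMod 2)) := by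
    intro v hv
    induction hv with
    | refl => exact Submodule.subset_span (by simp [S])
    | @tail z v _ hzv ih =>
      obtain ⟨e, he⟩ := hzv
      have h1 : edgeVector z v ∈ Submodule.span (ZMod 2) (S : Set (α →₀ ZMod 2)) := by
        rw [edgeVector_eq_of_isLink he (hab ⟨e, he.edge_mem⟩)]
        exact Submodule.subset_span (by simp [S])
      have h2 : (Finsupp.single v 1 : α →₀ ZMod 2) = edgeVector z v - Finsupp.single z 1 := by
        rw [edgeVector, add_sub_cancel_left]
      rw [h2]
      exact Submodule.sub_mem _ h1 ih
  have : Fintype V(T) := hV.fintype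
  have hli : LinearIndependent (ZMod 2) (fun v : V(T) => (Finsupp.single v.1 1 : α →₀ ZMod 2)) :=
    (Finsupp.linearIndependent_single_one (ZMod 2) α).comp _ Subtype.val_injective
  have h1 : Module.finrank (ZMod 2) (Submodule.span (ZMod 2)
      (Set.range fun v : V(T) => (Finsupp.single v.1 1 : α →₀ ZMod 2))) ≤ S.card := by
    refine (Submodule.finrank_mono (Submodule.span_le.2 ?_)).trans (finrank_span_finset_le_card S)
    rintro _ ⟨v, rfl⟩
    exact key v (h.2 w hw v v.2)
  rw [finrank_span_eq_card hli, ← Nat.card_eq_fintype_card, Nat.card_coe_set_eq] at h1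
  refine h1.trans ((Finset.card_insert_le _ _).trans (Nat.add_le_add_right ?_ 1))
  refine Finset.card_image_le.trans ?_
  rw [Finset.card_univ, ← Nat.card_eq_fintype_card, Nat.card_coe_set_eq]

/-- Along the edges in `B` one can walk between the ends of any edge whose incidence vector lies in
the span of `B`. -/
lemma reflTransGen_of_edgeVector_mem {ι : Type*} {a b : ι → α} {B : Finset ι} {x y : α}
    (h : edgeVector x y ∈ edgeSpan a b B) :
    Relation.ReflTransGen
      (fun u w => ∃ f ∈ B, (a f = u ∧ b f = w) ∨ (b f = u ∧ a f = w)) x y := by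
  set r : α → α → Prop := fun u w => ∃ f ∈ B, (a f = u ∧ b f = w) ∨ (b f = u ∧ a f = w)
  -- `φ` adds the coordinates at vertices reachable from `x`. It kills every edge of `B`, but would
  -- be 1 on `edgeVector x y` if `y` were unreachable.
  let φ : (α →₀ ZMod 2) →ₗ[ZMod 2] ZMod 2 :=
    Finsupp.linearCombination (ZMod 2) fun v => if Relation.ReflTransGen r x v then 1 else 0
  have hφ : ∀ u w, φ (edgeVector u w) = (if Relation.ReflTransGen r x u then 1 else 0) +
      (if Relation.ReflTransGen r x w then 1 else 0) := by
    intro u w; simp [φ, edgeVector]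
  have hker : edgeSpan a b B ≤ LinearMap.ker φ := by
    refine Submodule.span_le.2 ?_
    rintro _ ⟨f, hf, rfl⟩
    have hiff : Relation.ReflTransGen r x (a f) ↔ Relation.ReflTransGen r x (b f) :=
      ⟨fun h => h.tail ⟨f, hf, .inl ⟨rfl, rfl⟩⟩, fun h => h.tail ⟨f, hf, .inr ⟨rfl, rfl⟩⟩⟩
    simp only [SetLike.mem_coe, LinearMap.mem_ker, hφ, hiff]
    exact CharTwo.add_self_eq_zero _
  have h0 : φ (edgeVector x y) = 0 := hker h
  by_contra hxy
  rw [hφ, if_pos .refl, if_neg hxy] at h0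
  simp at h0

lemma hasCycle_of_reflTransGen {e : β} {x y : α} (he : T.IsLink e x y)
    (h : Relation.ReflTransGen (fun u w => ∃ f, f ≠ e ∧ T.IsLink f u w) x y) : T.HasCycle := by
  set r : α → α → Prop := fun u w => ∃ f, f ≠ e ∧ T.IsLink f u w
  -- Passing to a simple graph lets the walk be shortened to a path, which `e` then closes up. If `x
  -- = y`, the path has length 0 and `e` is a loop.
  have hreach : (SimpleGraph.fromRel r).Reachable x y := by
    clear he
    induction h with
    | refl => exact .refl _
    | @tail z w _ hzw ih =>
      by_cases hne : z = w
      · exact hne ▸ ih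
      · exact ih.trans (SimpleGraph.Adj.reachable ((SimpleGraph.fromRel_adj r z w).2
          ⟨hne, .inl hzw⟩))
  obtain ⟨p, hp⟩ := hreach.exists_isPath
  have hstep : ∀ i < p.length, ∃ f, f ≠ e ∧ T.IsLink f (p.getVert i) (p.getVert (i + 1)) := by
    intro i hi
    rcases ((SimpleGraph.fromRel_adj r _ _).1 (p.adj_getVert_succ hi)).2 with h | ⟨f, hf, hl⟩
    exacts [h, ⟨f, hf, hl.symm⟩]
  have : Nonempty β := ⟨e⟩
  choose! g hge hgl using hstep
  have hinj : ∀ i j, i ≤ p.length → j ≤ p.length → p.getVert i = p.getVert j → i = j :=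
    fun i j hi hj hij => hp.getVert_injOn hi hj hij
  refine ⟨p.length, fun i => p.getVert i, fun i => if i.1 < p.length then g i else e, ?_, ?_, ?_⟩
  · intro i j hij
    exact Fin.ext (hinj i j (by omega) (by omega) hij)
  · intro i j hij
    simp only at hij
    split_ifs at hij with hi hj hj
    · have h1 := hgl i hi
      rw [hij] at h1
      rcases h1.eq_and_eq_or_eq_and_eq (hgl j hj) with ⟨h2, -⟩ | ⟨h2, h3⟩
      · exact Fin.ext (hinj _ _ (by omega) (by omega) h2)
      -- An edge repeated in the opposite direction would force `i = j + 1` and `i + 1 = j`.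
      · have h4 := hinj _ _ (by omega) (by omega) h2
        have h5 := hinj _ _ (by omega) (by omega) h3
        omega
    · exact absurd hij (hge i hi)
    · exact absurd hij.symm (hge j hj)
    · exact Fin.ext (by omega)
  · intro i
    simp only
    split_ifs with hi
    · have : ((i + 1 : Fin (p.length + 1)) : ℕ) = i + 1 :=
        Fin.val_add_one_of_lt (by simpa [Fin.lt_def] using hi)
      rw [this]
      exact hgl i hi
    · have hi' : i = Fin.last _ := Fin.ext (by simp; omega)
      subst hi'
      simpa using he.symm

lemma edgeBounded_one_of_not_hasCycle (h : ¬ T.HasCycle) (hE : E(T).Finite) :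
    T.EdgeBounded 1 := by
  have : Fintype E(T) := hE.fintype
  obtain ⟨a, b, hab⟩ := T.exists_ends
  -- Without cycles the incidence vectors are independent: an edge in the span of others closes a
  -- walk through them.
  have hrank : ∀ A : Finset E(T), A.card ≤ edgeRank a b A := by
    intro A
    induction A using Finset.induction_on with
    | empty => simp
    | insert e B heB ih =>
      rw [Finset.card_insert_of_notMem heB]
      refine lt_of_le_of_lt ih (Submodule.finrank_lt_finrank_of_lt
        (lt_of_le_of_ne (edgeSpan_mono (Finset.subset_insert _ _)) fun heq => h ?_))
      have h1 : edgeVector (a e) (b e) ∈ edgeSpan a b B :=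
        heq ▸ edgeVector_mem_edgeSpan (Finset.mem_insert_self e B)
      refine hasCycle_of_reflTransGen (hab e)
        (Relation.ReflTransGen.mono ?_ _ _ (reflTransGen_of_edgeVector_mem h1))
      rintro u w ⟨f, hf, hfl⟩
      refine ⟨f, fun hfe => heB (Subtype.ext hfe ▸ hf), ?_⟩
      rcases hfl with ⟨rfl, rfl⟩ | ⟨rfl, rfl⟩
      exacts [hab f, (hab f).symm]
  intro F hF W hW hne hFW
  have : Fintype W := hW.fintype
  have h1 := (Nat.add_le_add_right (hrank (Finset.univ.filter fun e : E(T) => e.1 ∈ F)) 1).trans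
    (edgeRank_add_one_le (W := W.toFinset) (by simpa using hne) (by
      intro e he
      simpa using hFW e (by simpa using he) _ _ (hab e)))
  rwa [card_filter_val_mem hF, ← Set.ncard_eq_toFinset_card'] at h1

lemma isTree_iff_edgeBounded (hV : V(T).Finite) (hE : E(T).Finite) :
    T.IsTree ↔ T.EdgeBounded 1 ∧ E(T).ncard + 1 = V(T).ncard := by
  constructor
  · rintro ⟨hc, ha⟩
    have hb := edgeBounded_one_of_not_hasCycle ha hE
    exact ⟨hb, le_antisymm (hb _ subset_rfl _ hV hc.1 fun e _ x y h => ⟨h.left_mem, h.right_mem⟩)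
      (hc.ncard_vertexSet_le hV hE)⟩
  · rintro ⟨hb, hcard⟩
    exact ⟨hb.isConnected hV hE hcard, hb.not_hasCycle⟩

lemma isMapGraph_iff_edgeBounded (hV : V(M).Finite) (hE : E(M).Finite) :
    M.IsMapGraph ↔ M.EdgeBounded 0 ∧ E(M).ncard = V(M).ncard := by
  have : Fintype E(M) := hE.fintype
  have : Fintype V(M) := hV.fintype
  constructor
  · rintro ⟨O, hO⟩
    -- Out-degree one everywhere means that the tail map is a bijection from edges to vertices.
    let t : E(M) → V(M) := fun e => ⟨O.tail e, (O.isLink e).left_mem⟩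
    have hbij : Function.Bijective t := by
      constructor
      · intro e f hef
        obtain ⟨g, hg⟩ := Set.encard_eq_one.1 (hO (O.tail f) (O.isLink f).left_mem)
        have h1 : e ∈ {e | O.tail e = O.tail f} := congrArg Subtype.val hef
        have h2 : f ∈ {e | O.tail e = O.tail f} := rfl
        rw [hg] at h1 h2
        exact h1.trans h2.symm
      · rintro ⟨v, hv⟩
        obtain ⟨g, hg⟩ := Set.encard_eq_one.1 (hO v hv)
        have h1 : g ∈ {e | O.tail e = v} := hg ▸ rfl
        exact ⟨g, Subtype.ext h1⟩
    refine ⟨fun F hF W hW _ hFW => ?_, Nat.card_congr (Equiv.ofBijective t hbij)⟩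
    have : Fintype W := hW.fintype
    rw [add_zero, ← card_filter_val_mem hF, Set.ncard_eq_toFinset_card']
    refine Finset.card_le_card_of_injOn O.tail (fun e he => ?_) fun e _ f _ hef =>
      hbij.1 (Subtype.ext hef)
    simpa using (hFW e (by simpa using he) _ _ (O.isLink e)).1
  · rintro ⟨hb, hcard⟩
    obtain ⟨a, b, hab⟩ := M.exists_ends
    -- The edge bound is Hall's condition for assigning distinct tails to the edges; the equal
    -- cardinalities then make the assignment onto.
    obtain ⟨t, htinj, ht⟩ := (Finset.all_card_le_biUnion_card_iff_exists_injective
      (fun e : E(M) => ({a e, b e} : Finset α))).1 (by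
        intro A
        rcases A.eq_empty_or_nonempty with rfl | ⟨e, he⟩
        · simp
        have := hb (Subtype.val '' (A : Set E(M))) (by simp)
          (A.biUnion fun e => ({a e, b e} : Finset α) : Finset α) (Finset.finite_toSet _)
          ⟨a e, Finset.mem_coe.2 (Finset.mem_biUnion.2 ⟨e, he, by simp⟩)⟩ (by
            rintro _ ⟨f, hf, rfl⟩ x y hxy
            simp only [Finset.mem_coe, Finset.mem_biUnion]
            rcases hxy.eq_and_eq_or_eq_and_eq (hab f) with ⟨rfl, rfl⟩ | ⟨rfl, rfl⟩
            · exact ⟨⟨f, hf, by simp⟩, ⟨f, hf, by simp⟩⟩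
            · exact ⟨⟨f, hf, by simp⟩, ⟨f, hf, by simp⟩⟩)
        rwa [Set.ncard_image_of_injective _ Subtype.val_injective, Set.ncard_coe_finset,
          Set.ncard_coe_finset] at this)
    have ht' : ∀ e, t e = a e ∨ t e = b e := by simpa using ht
    have hlink : ∀ e : E(M), M.IsLink e (t e) (if t e = a e then b e else a e) := by
      intro e
      split_ifs with h
      · rw [h]; exact hab e
      · rw [(ht' e).resolve_left h]; exact (hab e).symm
    refine ⟨⟨t, _, hlink⟩, fun v hv => ?_⟩
    have hsurj : Function.Surjective (fun e => (⟨t e, (hlink e).left_mem⟩ : V(M))) := by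
      refine ((Fintype.bijective_iff_injective_and_card _).2 ⟨fun e f hef => ?_, ?_⟩).2
      · exact htinj (congrArg Subtype.val hef)
      · rwa [← Nat.card_eq_fintype_card, ← Nat.card_eq_fintype_card]
    obtain ⟨e, he⟩ := hsurj ⟨v, hv⟩
    refine Set.encard_eq_one.2 ⟨e, Set.ext fun f => ⟨fun hf => ?_, ?_⟩⟩
    · exact htinj (Eq.trans hf (congrArg Subtype.val he).symm)
    · rintro rfl
      exact congrArg Subtype.val he

end EdgeBound

end Graph
-- From decompositions to tightness and back.
namespace Graph

section Decomposition

open scoped Classical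

variable {α β : Type*} {G H : Graph α β}

lemma IsDecomposition.ncard_inter_eq_sum {κ : Type*} [Fintype κ] {K : κ → Graph α β}
    (h : G.IsDecomposition K) (hE : E(G).Finite) {F : Set β} (hF : F ⊆ E(G)) :
    F.ncard = ∑ i, (F ∩ E(K i)).ncard := by
  rw [← finsum_eq_sum_of_fintype, ← Set.ncard_iUnion_of_finite, ← Set.inter_iUnion, h.2.2,
    Set.inter_eq_left.2 hF]
  · exact fun i => (hE.subset hF).subset Set.inter_subset_left
  · exact fun i j hij => (h.2.1 i j hij).mono Set.inter_subset_right Set.inter_subset_right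

lemma IsDecomposition.ncard_edgeSet_eq_sum {κ : Type*} [Fintype κ] {K : κ → Graph α β}
    (h : G.IsDecomposition K) (hE : E(G).Finite) : E(G).ncard = ∑ i, E(K i).ncard := by
  rw [h.ncard_inter_eq_sum hE subset_rfl]
  refine Finset.sum_congr rfl fun i _ => ?_
  rw [Set.inter_eq_right.2 (IsSubgraph.edgeSet_mono (h.1 i))]

/-- Every subgraph inherits the edge bounds of the parts of a decomposition. -/
lemma EdgeBounded.ncard_inter_add_le {K : Graph α β} {d : ℕ} (hb : K.EdgeBounded d) (hK : K ≤ G)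
    (hH : H ≤ G) (hV : V(G).Finite) (hne : V(H).Nonempty) :
    (E(H) ∩ E(K)).ncard + d ≤ V(H).ncard := by
  refine hb _ Set.inter_subset_right _ (hV.subset hH.vertexSet_mono) hne fun e he x y hxy => ?_
  have := (IsSubgraph.isLink_iff hH he.1).2 (hxy.mono hK)
  exact ⟨this.left_mem, this.right_mem⟩

lemma IsMapsAndTrees.isTight (hV : V(G).Finite) (hE : E(G).Finite) {k l : ℕ} (hlk : l ≤ k)
    (h : G.IsMapsAndTrees k l) : G.IsTight k l := by
  obtain ⟨M, T, hdec, hM, hT⟩ := h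
  have hM' := fun i => (isMapGraph_iff_edgeBounded ((hM i).1.vertexSet_eq ▸ hV)
    (hE.subset (IsSubgraph.edgeSet_mono (hM i).1.le))).1 (hM i).2
  have hT' := fun j => (isTree_iff_edgeBounded ((hT j).1.vertexSet_eq ▸ hV)
    (hE.subset (IsSubgraph.edgeSet_mono (hT j).1.le))).1 (hT j).2
  constructor
  · intro H hH hne
    have hVne : V(H).Nonempty := by
      obtain ⟨e, he⟩ := hne
      obtain ⟨x, y, hxy⟩ := H.exists_isLink_of_mem_edgeSet he
      exact ⟨x, hxy.left_mem⟩
    rw [hdec.ncard_inter_eq_sum hE (IsSubgraph.edgeSet_mono hH), Fintype.sum_sum_type]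
    have h1 : ∑ i, (E(H) ∩ E(M i)).ncard ≤ (k - l) * V(H).ncard := by
      simpa using Finset.sum_le_card_nsmul Finset.univ (fun i => (E(H) ∩ E(M i)).ncard) _
        fun i _ => (hM' i).1.ncard_inter_add_le (hM i).1.le hH hV hVne
    -- The `+ 1` per tree adds up to the `l` of the sparsity count without natural subtraction.
    have h2 : ∑ j, ((E(H) ∩ E(T j)).ncard + 1) ≤ l * V(H).ncard := by
      simpa using Finset.sum_le_card_nsmul Finset.univ (fun j => (E(H) ∩ E(T j)).ncard + 1) _
        fun j _ => (hT' j).1.ncard_inter_add_le (hT j).1.le hH hV hVne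
    rw [Finset.sum_add_distrib] at h2
    simp only [Finset.sum_const, Finset.card_univ, Fintype.card_fin, smul_eq_mul, mul_one] at h2
    simp only [Sum.elim_inl, Sum.elim_inr]
    have h3 : (k - l) * V(H).ncard + l * V(H).ncard = k * V(H).ncard := by
      rw [← add_mul, Nat.sub_add_cancel hlk]
    rw [le_sub_iff_add_le]
    exact_mod_cast (by linarith)
  · rw [hdec.ncard_edgeSet_eq_sum hE, Fintype.sum_sum_type]
    have h1 : ∑ i, E(M i).ncard = (k - l) * V(G).ncard := by
      simp [fun i => (hM' i).2.trans (congrArg Set.ncard (hM i).1.vertexSet_eq)]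
    have h2 : ∑ j, (E(T j).ncard + 1) = l * V(G).ncard := by
      simp [fun j => (hT' j).2.trans (congrArg Set.ncard (hT j).1.vertexSet_eq)]
    rw [Finset.sum_add_distrib] at h2
    simp only [Finset.sum_const, Finset.card_univ, Fintype.card_fin, smul_eq_mul, mul_one] at h2
    simp only [Sum.elim_inl, Sum.elim_inr]
    have h3 : (k - l) * V(G).ncard + l * V(G).ncard = k * V(G).ncard := by
      rw [← add_mul, Nat.sub_add_cancel hlk]
    rw [eq_sub_iff_add_eq]
    exact_mod_cast (by linarith)

lemma IsSparse.card_add_le {k l : ℕ} (h : G.IsSparse k l) {a b : E(G) → α}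
    (hab : ∀ e : E(G), G.IsLink e (a e) (b e)) {A : Finset E(G)} (hA : A.Nonempty) :
    A.card + l ≤ k * (endpoints a b A).card := by
  let F : Set β := Subtype.val '' (A : Set E(G))
  -- Sparsity is sharpest on the subgraph whose vertices are just the ends of `A`.
  let K := (G.restrict F).induce (endpoints a b A : Set α)
  have hK : K ≤ G := by
    refine (induce_le ?_).trans restrict_le
    intro v hv
    obtain ⟨e, -, rfl | rfl⟩ := mem_endpoints.1 (Finset.mem_coe.1 hv)
    exacts [(hab e).left_mem, (hab e).right_mem]
  have hKE : E(K) = F := by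
    ext e
    constructor
    · rintro ⟨x, y, hxy, -⟩
      exact hxy.1
    · rintro ⟨e, he, rfl⟩
      exact ⟨a e, b e, ⟨⟨e, he, rfl⟩, hab e⟩, mem_endpoints.2 ⟨e, he, .inl rfl⟩,
        mem_endpoints.2 ⟨e, he, .inr rfl⟩⟩
  have := h K hK (by rw [hKE]; exact (Finset.coe_nonempty.2 hA).image _)
  rw [hKE, Set.ncard_image_of_injective _ Subtype.val_injective, Set.ncard_coe_finset] at this
  have hKV : V(K).ncard = (endpoints a b A).card := Set.ncard_coe_finset _
  rw [hKV] at this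
  zify
  linarith

lemma IsSparse.exists_decomposition (hE : E(G).Finite) {k l : ℕ} (hlk : l ≤ k)
    (h : G.IsSparse k l) :
    ∃ K : Fin (k - l) ⊕ Fin l → Graph α β, G.IsDecomposition K ∧ (∀ i, K i ≤s G) ∧
      (∀ i, (K (.inl i)).EdgeBounded 0) ∧ ∀ j, (K (.inr j)).EdgeBounded 1 := by
  have : Fintype E(G) := hE.fintype
  obtain ⟨a, b, hab⟩ := G.exists_ends
  obtain ⟨c, hc⟩ := exists_coloring_of_card_le_sum
    (Sum.elim (fun (_ : Fin (k - l)) A => (endpoints a b A).card)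
      fun (_ : Fin l) A => edgeRank a b A)
    (by rintro (i | j) <;> simp [endpoints, edgeRank_empty])
    (by
      rintro (i | j) A B hAB
      exacts [Finset.card_le_card (endpoints_mono hAB), edgeRank_mono hAB])
    (by
      rintro (i | j) A B
      exacts [card_endpoints_submodular A B, edgeRank_submodular A B])
    (by
      intro A
      simpa using card_le_of_sparse (m := k - l) (l := l)
        (fun B hB => by simpa [Nat.sub_add_cancel hlk] using h.card_add_le hab hB) A)
  let F : Fin (k - l) ⊕ Fin l → Set β := fun i => Subtype.val '' {e | c e = i}
  have hFE : ∀ i, E(G.restrict (F i)) = F i := fun i => Set.inter_eq_right.2 (by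
    rintro _ ⟨e, -, rfl⟩; exact e.2)
  have hcol : ∀ i, ∀ F' ⊆ E(G.restrict (F i)), F' ⊆ E(G) ∧
      ∀ e ∈ Finset.univ.filter fun e : E(G) => e.1 ∈ F', c e = i := by
    intro i F' hF'
    refine ⟨fun e he => (hF' he).1, fun e he => ?_⟩
    obtain ⟨f, hf, hfe⟩ := (hF' (Finset.mem_filter.1 he).2).2
    exact Subtype.ext hfe ▸ hf
  have hends : ∀ i, ∀ F' ⊆ E(G.restrict (F i)), ∀ W : Set α,
      (∀ e ∈ F', ∀ x y, (G.restrict (F i)).IsLink e x y → x ∈ W ∧ y ∈ W) →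
      ∀ e ∈ Finset.univ.filter fun e : E(G) => e.1 ∈ F', a e ∈ W ∧ b e ∈ W := by
    intro i F' hF' W hFW e he
    have he' := (Finset.mem_filter.1 he).2
    exact hFW e he' _ _ ⟨(hF' he').2, hab e⟩
  refine ⟨fun i => G.restrict (F i), ⟨fun i => restrict_le, fun i j hij => ?_, ?_⟩,
    fun i => ⟨restrict_le, rfl⟩, fun i F' hF' W hW _ hFW => ?_, fun j F' hF' W hW hne hFW => ?_⟩
  · rw [hFE, hFE, Set.disjoint_left]
    rintro _ ⟨e, he, rfl⟩ ⟨f, hf, hfe⟩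
    exact hij (he.symm.trans ((congrArg c (Subtype.ext hfe)).symm.trans hf))
  · simp_rw [hFE]
    refine Set.Subset.antisymm (Set.iUnion_subset fun i => ?_) fun e he =>
      Set.mem_iUnion.2 ⟨c ⟨e, he⟩, ⟨e, he⟩, rfl, rfl⟩
    rintro _ ⟨e, -, rfl⟩
    exact e.2
  · obtain ⟨hF, hcF⟩ := hcol _ F' hF'
    have : Fintype W := hW.fintype
    rw [add_zero, ← card_filter_val_mem hF, Set.ncard_eq_toFinset_card']
    refine (hc _ _ hcF).trans (Finset.card_le_card (endpoints_subset_iff.2 fun e he => ?_))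
    simpa using hends _ F' hF' W hFW e he
  · obtain ⟨hF, hcF⟩ := hcol _ F' hF'
    have : Fintype W := hW.fintype
    rw [← card_filter_val_mem hF, Set.ncard_eq_toFinset_card']
    refine (Nat.add_le_add_right (hc _ _ hcF) 1).trans
      (edgeRank_add_one_le (by simpa using hne) fun e he => ?_)
    simpa using hends _ F' hF' W hFW e he

lemma IsTight.isMapsAndTrees (hV : V(G).Finite) (hE : E(G).Finite) {k l : ℕ} (hlk : l ≤ k)
    (h : G.IsTight k l) : G.IsMapsAndTrees k l := by
  obtain ⟨K, hdec, hK, hM, hT⟩ := h.1.exists_decomposition hE hlk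
  have hKV := fun i => (hK i).vertexSet_eq
  have hKfin : ∀ i, E(K i).Finite := fun i => hE.subset (IsSubgraph.edgeSet_mono (hK i).le)
  have hcard : E(G).ncard + l = k * V(G).ncard := by have := h.2; zify; linarith
  -- `EdgeBounded` speaks only of nonempty vertex sets, so the empty graph needs separate care here
  -- and in `hMle`.
  have hne : 0 < l → V(G).Nonempty := by
    intro hl
    by_contra hcon
    rw [Set.not_nonempty_iff_eq_empty] at hcon
    rw [hcon, Set.ncard_empty] at hcard
    omega
  have hMle : ∀ i, E(K (.inl i)).ncard ≤ V(G).ncard := by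
    intro i
    rcases V(G).eq_empty_or_nonempty with hemp | hVne
    · rw [Set.ncard_eq_zero (hKfin _) |>.2]
      · exact Nat.zero_le _
      · refine Set.eq_empty_of_forall_notMem fun e he => ?_
        obtain ⟨x, y, hxy⟩ := exists_isLink_of_mem_edgeSet he
        have := hxy.left_mem
        rw [hKV, hemp] at this
        exact this
    · exact hKV (.inl i) ▸ hM i _ subset_rfl _ (hKV (.inl i) ▸ hV) (hKV (.inl i) ▸ hVne)
        fun e _ x y hxy => ⟨hxy.left_mem, hxy.right_mem⟩
  have hTle : ∀ j, E(K (.inr j)).ncard + 1 ≤ V(G).ncard := by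
    intro j
    exact hKV (.inr j) ▸ hT j _ subset_rfl _ (hKV (.inr j) ▸ hV)
      (hKV (.inr j) ▸ hne (Nat.zero_lt_of_lt j.2))
      fun e _ x y hxy => ⟨hxy.left_mem, hxy.right_mem⟩
  have hsum : ∑ i, (E(K (.inl i)).ncard) + ∑ j, (E(K (.inr j)).ncard + 1) =
      ∑ _i : Fin (k - l), V(G).ncard + ∑ _j : Fin l, V(G).ncard := by
    rw [Finset.sum_add_distrib]
    simp only [Finset.sum_const, Finset.card_univ, Fintype.card_fin, smul_eq_mul, mul_one]
    rw [← add_mul, Nat.sub_add_cancel hlk, ← hcard, hdec.ncard_edgeSet_eq_sum hE,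
      Fintype.sum_sum_type, add_assoc]
  have h1 := Finset.sum_le_sum fun i (_ : i ∈ Finset.univ) => hMle i
  have h2 := Finset.sum_le_sum fun j (_ : j ∈ Finset.univ) => hTle j
  -- By `hsum` the totals of the two sides agree, so no single bound can be strict.
  have hMeq := (Finset.sum_eq_sum_iff_of_le fun i (_ : i ∈ Finset.univ) => hMle i).1 (by omega)
  have hTeq := (Finset.sum_eq_sum_iff_of_le fun j (_ : j ∈ Finset.univ) => hTle j).1 (by omega)
  refine ⟨fun i => K (.inl i), fun j => K (.inr j), ?_, fun i => ⟨hK _, ?_⟩, fun j => ⟨hK _, ?_⟩⟩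
  · convert hdec using 1
    ext i : 1
    rcases i with i | j <;> rfl
  · exact (isMapGraph_iff_edgeBounded (hKV (.inl i) ▸ hV) (hKfin _)).2
      ⟨hM i, by rw [hKV]; exact hMeq i (Finset.mem_univ i)⟩
  · exact (isTree_iff_edgeBounded (hKV (.inr j) ▸ hV) (hKfin _)).2
      ⟨hT j, by rw [hKV]; exact hTeq j (Finset.mem_univ j)⟩

lemma isDecomposition_comp_equiv {κ κ' : Type*} {K : κ → Graph α β} (f : κ' ≃ κ) :
    G.IsDecomposition (K ∘ f) ↔ G.IsDecomposition K := by
  unfold IsDecomposition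
  refine and_congr (f.forall_congr_right (q := fun i => K i ≤ G)) (and_congr ?_ ?_)
  · refine ⟨fun h i j hij => ?_, fun h i j hij => h _ _ (f.injective.ne hij)⟩
    simpa using h (f.symm i) (f.symm j) (f.symm.injective.ne hij)
  · rw [← f.surjective.iUnion_comp fun i => E(K i)]; rfl

lemma isMapsAndTrees_self_iff {k : ℕ} : G.IsMapsAndTrees k k ↔ G.IsArborescence k := by
  have : IsEmpty (Fin (k - k)) := by rw [Nat.sub_self]; infer_instance
  have key : ∀ (M : Fin (k - k) → Graph α β) (T : Fin k → Graph α β),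
      G.IsDecomposition (Sum.elim M T) ↔ G.IsDecomposition T := fun M T => by
    rw [← isDecomposition_comp_equiv (Equiv.emptySum (Fin (k - k)) (Fin k)).symm]
    rfl
  constructor
  · rintro ⟨M, T, hdec, -, hT⟩
    exact ⟨T, (key M T).1 hdec, hT⟩
  · rintro ⟨T, hdec, hT⟩
    exact ⟨isEmptyElim, T, (key _ T).2 hdec, isEmptyElim, hT⟩

end Decomposition

end Graph

/-- For a finite multigraph and `0 ≤ ℓ ≤ k`, being `(k, ℓ)`-tight is equivalent to having a
`(k, ℓ)`-maps-and-trees decomposition; in particular the `(k, k)`-tight graphs are those that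
decompose into `k` edge-disjoint spanning trees. -/
theorem mainTheorem5 {α β : Type*} (G : Graph α β)
    (hV : G.vertexSet.Finite) (hE : G.edgeSet.Finite) (k : ℕ) :
    (∀ ℓ : ℕ, ℓ ≤ k → (G.IsTight k ℓ ↔ G.IsMapsAndTrees k ℓ)) ∧
    (G.IsTight k k ↔ G.IsArborescence k) := by
  have h : ∀ ℓ : ℕ, ℓ ≤ k → (G.IsTight k ℓ ↔ G.IsMapsAndTrees k ℓ) := fun ℓ hℓ =>
    ⟨fun hG => hG.isMapsAndTrees hV hE hℓ, fun hG => hG.isTight hV hE hℓ⟩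
  exact ⟨h, (h k le_rfl).trans Graph.isMapsAndTrees_self_iff⟩
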